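/- Let $K\ge 1$, let $\Omega\subseteq\mathbb R^2$ be measurable, and let $f\ge 0$ be an integrable density of mobile terminals on $\Omega$ (normalized or not). Let the $K$ base stations stand at distinct points of the plane, let $d_i(x)$ be the Euclidean distance from $x$ to the $i$-th station, and let $\sigma>0$, $R\ge 0$, $\xi>0$. Put $F_i(x)=\sigma^2(R^2+d_i(x)^2)^{\xi/2}$, and assume $\int_\Omega F_i f\,dx<\infty$ for every $i$ (automatic for bounded $\Omega$). For $\mathrm{MAX}_i\ge 0$ and functions $\bar\kappa_i$ let $$s_i(t)=\kappa_i(t)=\begin{cases}0,& t\le \mathrm{MAX}_i,\\ \bar\kappa_i(t-\mathrm{MAX}_i),& t>\mathrm{MAX}_i,\end{cases}$$ and assume that each $s_i$ is non-decreasing and convex on $[0,\infty)$ (for instance $\bar\kappa_i(u)=c_i u$ with a constant $c_i\ge 0$, or $\bar\kappa_i(u)=c_iu^2$). Consider the rate-fair allocation problem with overflow penalty $$\min_{(C_i)}\ \sum_{i=1}^K\int_{C_i}\bigl[F_i(x)+s_i(N_i)\bigr]f(x)\,dx,\qquad N_i=\int_{C_i}f(x)\,dx,$$ over all partitions $(C_i)_{i=1}^K$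 of $\Omega$ into measurable cells (possibly empty). 1. The problem has an optimal partition, and it is unique: the $i$-th cells of any two optimal partitions agree up to a set of $f\,dx$-measure zero, for every $i$. 2. A partition $(C_i)$ of $\Omega$ into measurable cells, with $N_i=\int_{C_i}f\,dx$, is optimal if and only if there are numbers $g_i$, each a subgradient at $N_i$ of $s_i$ as a function on $[0,\infty)$ (that is, $s_i(u)\ge s_i(N_i)+g_i(u-N_i)$ for all $u\ge 0$), such that for every $i$, up to a set of $f\,dx$-measure zero, $$C_i=\{x\in\Omega:\ F_i(x)+s_i(N_i)+N_i\,g_i\le F_j(x)+s_j(N_j)+N_j\,g_j\ \text{ for all } j\}.$$ 3. In particular, if each $s_i$ is differentiable at $N_i$ (as is always the case when the $s_i$ are continuously differentiable), the partition is optimal if and only if for every $i$, up to a set of $f\,dx$-measure zero, $$C_i=\{x\in\Omega:\ \sigma^2(R^2+d_i(x)^2)^{\xi/2}+s_i(N_i)+N_i\,s_i'(N_i)\le \sigma^2(R^2+d_j(x)^2)^{\xi/2}+s_j(N_j)+N_j\,s_j'(N_j)\ \text{ for all } j\}.$$ -/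

import Mathlib

open MeasureTheory

noncomputable section

/-- The plane, with its Euclidean distance. -/
abbrev Plane : Type := EuclideanSpace ℝ (Fin 2)

/-- The carrier-overflow penalty `κ`: zero up to the capacity `M`, then `κbar (t - M)`. -/
def overflowPenalty (M : ℝ) (κbar : ℝ → ℝ) (t : ℝ) : ℝ :=
  if t ≤ M then 0 else κbar (t - M)

/-- The power `σ² (R² + d²)^(ξ/2)` for a mobile at `x` and a base station at `b`. -/
def linkPower (σ R ξ : ℝ) (b x : Plane) : ℝ :=
  σ ^ 2 * (R ^ 2 + dist x b ^ 2) ^ (ξ / 2)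

/-- The amount `∫_A f` of mobiles in `A`, for the deployment density `f`. -/
def mobilesIn (f : Plane → ℝ) (A : Set Plane) : ℝ := ∫ x in A, f x

/-- The measure on `Ω` with density `f`. -/
def mobileMeasure (Ω : Set Plane) (f : Plane → ℝ) : Measure Plane :=
  (volume.restrict Ω).withDensity fun x => ENNReal.ofReal (f x)

/-- `C` is a partition of `Ω` into measurable cells (some of which may be empty). -/
structure IsCellPartition {K : ℕ} (Ω : Set Plane) (C : Fin K → Set Plane) : Prop where
  measurableSet : ∀ i, MeasurableSet (C i)
  disjoint : Pairwise fun i j => Disjoint (C i) (C j)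
  iUnion_eq : ⋃ i, C i = Ω

/-- The cost `∑ i, ∫_{C i} [F i (x) + s i (N i)] f(x) dx`, with `N i = ∫_{C i} f`. -/
def partitionCost {K : ℕ} (F : Fin K → Plane → ℝ) (s : Fin K → ℝ → ℝ) (f : Plane → ℝ)
    (C : Fin K → Set Plane) : ℝ :=
  ∑ i, ∫ x in C i, (F i x + s i (mobilesIn f (C i))) * f x

/-- `C` minimizes the cost among all cell partitions of `Ω`. -/
def IsOptimalPartition {K : ℕ} (Ω : Set Plane) (F : Fin K → Plane → ℝ) (s : Fin K → ℝ → ℝ)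
    (f : Plane → ℝ) (C : Fin K → Set Plane) : Prop :=
  IsCellPartition Ω C ∧
    ∀ D : Fin K → Set Plane, IsCellPartition Ω D →
      partitionCost F s f C ≤ partitionCost F s f D

/-- The set of `x ∈ Ω` with `F i x + s i (n i) + n i * g i ≤ F j x + s j (n j) + n j * g j`
for all `j`. -/
def associationCell {K : ℕ} (Ω : Set Plane) (F : Fin K → Plane → ℝ) (s : Fin K → ℝ → ℝ)
    (n g : Fin K → ℝ) (i : Fin K) : Set Plane :=
  {x | x ∈ Ω ∧ ∀ j, F i x + s i (n i) + n i * g i ≤ F j x + s j (n j) + n j * g j}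

/-- `g` is a subgradient at `t` of `s` as a function on `[0, ∞)`. For convex `s` and `t > 0`
this means that `g` lies between the left and the right derivative of `s` at `t`. -/
def IsLoadSubgradient (s : ℝ → ℝ) (t g : ℝ) : Prop :=
  ∀ u : ℝ, 0 ≤ u → s t + g * (u - t) ≤ s u

end

noncomputable section

/-! Write μ for `f dx` on Ω. The cost is ∑ ∫_{C_i} F_i dμ + ∑ N_i s_i(N_i), and each t s_i(t) is
convex, since s_i is convex and non-decreasing with s_i(0) = 0. Charge station i a price h_i per
unit of load. If h_i is a subgradient of t s_i(t) at N_i and the cells are the sets where F_i + h_i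
is minimal, then linearizing the load costs shows that every other partition costs at least as much.
The gap is at least its total excess over min_j (F_j + h_j) (`loadCost_le_and_ae_eq`). Zero excess
puts its cells inside the price cells, which overlap only in null sets because F_i - F_j = c is null
for distinct stations (`volume_setOf_linkPower_sub_eq`). This gives optimality and uniqueness.

Suitable prices come from a saddle point, by Sion's theorem, of a Lagrangian in which the loads are
decoupled from the cells (`exists_prices`). The lemmas `IsLoadSubgradient.mul_self` and
`exists_isLoadSubgradient` translate between subgradients g of s and subgradients s(n) + n g of t
s(t). By uniqueness every optimal partition inherits these prices, which is the necessity of the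
criterion. -/

/-! ### Ties between two stations form a null set. -/

theorem measurable_linkPower (σ R ξ : ℝ) (b : Plane) : Measurable (linkPower σ R ξ b) := by
  unfold linkPower
  fun_prop

/-- The power is a strictly increasing function of the distance. -/
theorem strictMonoOn_power {σ R ξ : ℝ} (hσ : 0 < σ) (hξ : 0 < ξ) :
    StrictMonoOn (fun d : ℝ => σ ^ 2 * (R ^ 2 + d ^ 2) ^ (ξ / 2)) (Set.Ici 0) := by
  intro a ha c hc hac
  have ha' : 0 ≤ a := ha
  have h2 : a ^ 2 < c ^ 2 := by gcongr
  have : (R ^ 2 + a ^ 2) ^ (ξ / 2) < (R ^ 2 + c ^ 2) ^ (ξ / 2) :=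
    Real.rpow_lt_rpow (by positivity) (by linarith) (by positivity)
  show σ ^ 2 * _ < σ ^ 2 * _
  gcongr

/-- Each circle around the origin meets each circle around `w ≠ 0` in countably many points. -/
theorem countable_setOf_norm_polarCoord_symm_sub_eq {w : ℂ} (hw : w ≠ 0) {r : ℝ} (hr : 0 < r)
    (c : ℝ) : {θ : ℝ | ‖Complex.polarCoord.symm (r, θ) - w‖ = c}.Countable := by
  -- Law of cosines: on a circle around 0 the distance to `w` determines the cosine of the angle to
  -- `w`.
  have key (θ : ℝ) : ‖Complex.polarCoord.symm (r, θ) - w‖ ^ 2 =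
      r ^ 2 + ‖w‖ ^ 2 - 2 * r * ‖w‖ * Real.cos (θ - w.arg) := by
    have hre : w.re = ‖w‖ * Real.cos w.arg := (Complex.norm_mul_cos_arg w).symm
    have him : w.im = ‖w‖ * Real.sin w.arg := (Complex.norm_mul_sin_arg w).symm
    have h1 : ‖w‖ ^ 2 = w.re ^ 2 + w.im ^ 2 := by
      rw [← Complex.normSq_eq_norm_sq, Complex.normSq_apply]; ring
    rw [← Complex.normSq_eq_norm_sq, Complex.normSq_apply, Real.cos_sub,
      Complex.polarCoord_symm_apply]
    simp only [Complex.sub_re, Complex.sub_im, Complex.mul_re, Complex.mul_im, Complex.add_re,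
      Complex.add_im, Complex.ofReal_re, Complex.ofReal_im, Complex.I_re, Complex.I_im]
    have h2 := Real.sin_sq_add_cos_sq θ
    rw [h1]
    linear_combination (r ^ 2) * h2 + 2 * r * (-Real.cos θ) * hre + 2 * r * (-Real.sin θ) * him
  rcases Set.eq_empty_or_nonempty {θ : ℝ | ‖Complex.polarCoord.symm (r, θ) - w‖ = c} with h | h
  · rw [h]; exact Set.countable_empty
  obtain ⟨θ₀, hθ₀⟩ := h
  have hw' : 0 < ‖w‖ := norm_pos_iff.2 hw
  refine ((Set.countable_range fun k : ℤ => 2 * k * Real.pi + (θ₀ - w.arg) + w.arg).union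
    (Set.countable_range fun k : ℤ => 2 * k * Real.pi - (θ₀ - w.arg) + w.arg)).mono ?_
  intro θ hθ
  have h1 := key θ
  have h2 := key θ₀
  rw [show ‖Complex.polarCoord.symm (r, θ) - w‖ = c from hθ] at h1
  rw [show ‖Complex.polarCoord.symm (r, θ₀) - w‖ = c from hθ₀] at h2
  have h3 : Real.cos (θ₀ - w.arg) = Real.cos (θ - w.arg) := by
    have h4 : 0 < 2 * r * ‖w‖ := by positivity
    apply mul_left_cancel₀ h4.ne'
    linarith
  obtain ⟨k, hk | hk⟩ := Real.cos_eq_cos_iff.1 h3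
  · exact Or.inl ⟨k, by simp only; linarith⟩
  · exact Or.inr ⟨k, by simp only; linarith⟩

/-- A planar set that meets each circle around the origin in finitely or countably many points is
null. -/
theorem volume_eq_zero_of_countable_polarCoord {A : Set ℂ} (hA : MeasurableSet A)
    (h : ∀ r : ℝ, 0 < r → {θ : ℝ | Complex.polarCoord.symm (r, θ) ∈ A}.Countable) :
    volume A = 0 := by
  rw [← lintegral_indicator_one hA, ← Complex.lintegral_comp_polarCoord_symm]
  have hm : Measurable fun p : ℝ × ℝ => Complex.polarCoord.symm p := by
    simp only [Complex.polarCoord_symm_apply]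
    fun_prop
  have hpm : MeasurableSet ((fun p : ℝ × ℝ => Complex.polarCoord.symm p) ⁻¹' A) := hm hA
  have hnull : (volume.restrict polarCoord.target)
      ((fun p : ℝ × ℝ => Complex.polarCoord.symm p) ⁻¹' A) = 0 := by
    rw [Measure.restrict_apply hpm, polarCoord_target, Measure.volume_eq_prod,
      Measure.measure_prod_null (hpm.inter (measurableSet_Ioi.prod measurableSet_Ioo))]
    refine Filter.Eventually.of_forall fun r => ?_
    by_cases hr : 0 < r
    · refine measure_mono_null ?_ ((h r hr).measure_zero volume)
      intro θ hθ
      exact hθ.1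
    · have : Prod.mk r ⁻¹' ((fun p : ℝ × ℝ => Complex.polarCoord.symm p) ⁻¹' A ∩
          Set.Ioi (0 : ℝ) ×ˢ Set.Ioo (-Real.pi) Real.pi) = ∅ := by
        ext θ
        simp [hr]
      show volume _ = 0
      rw [this, measure_empty]
  refine (lintegral_eq_zero_iff' ?_).2 ?_
  · refine Measurable.aemeasurable ?_
    exact (measurable_fst.ennreal_ofReal).smul ((measurable_one.indicator hA).comp hm)
  · have : ∀ᵐ p ∂(volume.restrict polarCoord.target),
        p ∉ (fun p : ℝ × ℝ => Complex.polarCoord.symm p) ⁻¹' A := measure_eq_zero_iff_ae_notMem.1 hnull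
    filter_upwards [this] with p hp
    have hp' : Complex.polarCoord.symm p ∉ A := hp
    simp only [Set.indicator_of_notMem hp', smul_zero, Pi.zero_apply]

/-- On the circle ‖z‖ = r the equation fixes `G ‖z - w‖`, hence ‖z - w‖ by injectivity. The set
therefore meets that circle inside a second circle with a different centre. -/
theorem volume_setOf_norm_sub_eq {G : ℝ → ℝ} (hG : Set.InjOn G (Set.Ici 0)) (hm : Measurable G)
    {w : ℂ} (hw : w ≠ 0) (c : ℝ) : volume {z : ℂ | G ‖z‖ - G ‖z - w‖ = c} = 0 := by
  apply volume_eq_zero_of_countable_polarCoord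
  · exact measurableSet_eq_fun (by fun_prop) measurable_const
  · intro r hr
    by_cases hne : ∃ θ₀, Complex.polarCoord.symm (r, θ₀) ∈ {z : ℂ | G ‖z‖ - G ‖z - w‖ = c}
    · obtain ⟨θ₀, hθ₀⟩ := hne
      refine (countable_setOf_norm_polarCoord_symm_sub_eq hw hr
        ‖Complex.polarCoord.symm (r, θ₀) - w‖).mono ?_
      intro θ hθ
      have h1 : G ‖Complex.polarCoord.symm (r, θ)‖ - G ‖Complex.polarCoord.symm (r, θ) - w‖ = c := hθ
      have h2 : G ‖Complex.polarCoord.symm (r, θ₀)‖ -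
        G ‖Complex.polarCoord.symm (r, θ₀) - w‖ = c := hθ₀
      rw [Complex.norm_polarCoord_symm] at h1 h2
      exact hG (norm_nonneg _) (norm_nonneg _) (by simp only at h1 h2; linarith)
    · push Not at hne
      exact Set.countable_empty.mono fun θ hθ => (hne θ hθ).elim

/-- The powers of two stations at distinct points differ by `c` only on a null set. -/
theorem volume_setOf_linkPower_sub_eq {σ R ξ : ℝ} (hσ : 0 < σ) (hξ : 0 < ξ) {p q : Plane}
    (hpq : p ≠ q) (c : ℝ) :
    volume {x | linkPower σ R ξ p x - linkPower σ R ξ q x = c} = 0 := by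
  set e := Complex.orthonormalBasisOneI.repr
  -- Coordinates in ℂ with `p` at the origin.
  have he : MeasurePreserving (fun z : ℂ => e z + p) :=
    (measurePreserving_add_right volume p).comp
      Complex.orthonormalBasisOneI.measurePreserving_repr
  have hms : MeasurableSet {x | linkPower σ R ξ p x - linkPower σ R ξ q x = c} :=
    measurableSet_eq_fun ((measurable_linkPower ..).sub (measurable_linkPower ..)) measurable_const
  rw [← he.measure_preimage hms.nullMeasurableSet]
  have hw : e.symm (q - p) ≠ 0 := by
    simpa [sub_eq_zero] using hpq.symm
  rw [← volume_setOf_norm_sub_eq (strictMonoOn_power (R := R) hσ hξ).injOn (by fun_prop) hw c]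
  congr 1
  ext z
  have h2 : dist (e z + p) q = ‖z - e.symm (q - p)‖ := by
    rw [← e.norm_map, map_sub, e.apply_symm_apply, dist_eq_norm]
    congr 1
    abel
  simp [linkPower, h2]

/-! ### The dual function ∫ min_j (F_j + h_j) dμ and the price cells. -/

section ShiftedMin

variable {α ι : Type*} {mα : MeasurableSpace α} {μ : Measure α} {F : ι → α → ℝ}

/-- The pointwise minimum of the functions `F j` shifted by the prices `h j`. -/
def shiftedMin (F : ι → α → ℝ) (h : ι → ℝ) (x : α) : ℝ := ⨅ j, (F j x + h j)

/-- The set of points at which `F i + h i` is minimal among all `F j + h j`. -/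
def priceCell (F : ι → α → ℝ) (h : ι → ℝ) (i : ι) : Set α :=
  {x | ∀ j, F i x + h i ≤ F j x + h j}

/-- Two of the functions differ by a given constant only on a null set. -/
def TiesNull (μ : Measure α) (F : ι → α → ℝ) : Prop :=
  ∀ i j, i ≠ j → ∀ c : ℝ, μ {x | F i x - F j x = c} = 0

theorem shiftedMin_le [Finite ι] (F : ι → α → ℝ) (h : ι → ℝ) (x : α) (j : ι) :
    shiftedMin F h x ≤ F j x + h j :=
  ciInf_le (Set.finite_range _).bddBelow j

theorem le_shiftedMin [Nonempty ι] {h : ι → ℝ} {x : α} {c : ℝ} (hc : ∀ j, c ≤ F j x + h j) :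
    c ≤ shiftedMin F h x :=
  le_ciInf hc

theorem exists_eq_shiftedMin [Finite ι] [Nonempty ι] (F : ι → α → ℝ) (h : ι → ℝ) (x : α) :
    ∃ j, F j x + h j = shiftedMin F h x :=
  exists_eq_ciInf_of_finite

theorem mem_priceCell_iff [Finite ι] [Nonempty ι] {h : ι → ℝ} {x : α} {i : ι} :
    x ∈ priceCell F h i ↔ F i x + h i = shiftedMin F h x :=
  ⟨fun hx => le_antisymm (le_shiftedMin hx) (shiftedMin_le F h x i),
    fun hx j => hx.trans_le (shiftedMin_le F h x j)⟩

theorem measurable_shiftedMin [Countable ι] (hF : ∀ i, Measurable (F i)) (h : ι → ℝ) :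
    Measurable (shiftedMin F h) :=
  Measurable.iInf fun i => (hF i).add_const (h i)

theorem measurableSet_priceCell [Countable ι] (hF : ∀ i, Measurable (F i)) (h : ι → ℝ) (i : ι) :
    MeasurableSet (priceCell F h i) := by
  have : priceCell F h i = ⋂ j, {x | F i x + h i ≤ F j x + h j} := by
    ext x; simp [priceCell]
  rw [this]
  exact MeasurableSet.iInter fun j =>
    measurableSet_le ((hF i).add_const _) ((hF j).add_const _)

theorem integrable_shiftedMin [Fintype ι] [Nonempty ι] [IsFiniteMeasure μ]
    (hF : ∀ i, Measurable (F i)) (hFi : ∀ i, Integrable (F i) μ) (h : ι → ℝ) :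
    Integrable (shiftedMin F h) μ := by
  refine Integrable.mono' (g := fun x => ∑ j, |F j x + h j|)
    (integrable_finsetSum _ fun j _ => ((hFi j).add (integrable_const (h j))).abs)
    (measurable_shiftedMin hF h).aestronglyMeasurable
    (Filter.Eventually.of_forall fun x => ?_)
  obtain ⟨j, hj⟩ := exists_eq_shiftedMin F h x
  rw [← hj, Real.norm_eq_abs]
  exact Finset.single_le_sum (f := fun j => |F j x + h j|) (fun _ _ => abs_nonneg _)
    (Finset.mem_univ j)

theorem concaveOn_integral_shiftedMin [Fintype ι] [Nonempty ι] [IsFiniteMeasure μ]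
    (hF : ∀ i, Measurable (F i)) (hFi : ∀ i, Integrable (F i) μ) :
    ConcaveOn ℝ Set.univ fun h => ∫ x, shiftedMin F h x ∂μ := by
  refine ⟨convex_univ, fun h _ k _ a b ha hb hab => ?_⟩
  simp only [smul_eq_mul]
  have hi := integrable_shiftedMin hF hFi (μ := μ)
  rw [← integral_const_mul, ← integral_const_mul,
    ← integral_add ((hi h).const_mul a) ((hi k).const_mul b)]
  refine integral_mono (((hi h).const_mul a).add ((hi k).const_mul b)) (hi _) fun x => ?_
  refine le_shiftedMin fun j => ?_
  have h1 := mul_le_mul_of_nonneg_left (shiftedMin_le F h x j) ha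
  have h2 := mul_le_mul_of_nonneg_left (shiftedMin_le F k x j) hb
  simp only [Pi.add_apply, Pi.smul_apply, smul_eq_mul]
  have h3 : F j x = a * F j x + b * F j x := by rw [← add_mul, hab, one_mul]
  linarith

/-- A finite concave function on a finite-dimensional space is continuous. -/
theorem continuous_integral_shiftedMin [Fintype ι] [Nonempty ι] [IsFiniteMeasure μ]
    (hF : ∀ i, Measurable (F i)) (hFi : ∀ i, Integrable (F i) μ) :
    Continuous fun h => ∫ x, shiftedMin F h x ∂μ :=
  continuousOn_univ.1 ((concaveOn_integral_shiftedMin hF hFi).continuousOn isOpen_univ)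

/-- Supergradient inequality for the integral of the minimum along a coordinate. -/
theorem mul_measure_priceCell_le [Fintype ι] [Nonempty ι] [DecidableEq ι] [IsFiniteMeasure μ]
    (hF : ∀ i, Measurable (F i)) (hFi : ∀ i, Integrable (F i) μ) (h : ι → ℝ) (i : ι) (t : ℝ) :
    (t - h i) * μ.real (priceCell F (Function.update h i t) i) ≤
      ∫ x, shiftedMin F (Function.update h i t) x ∂μ - ∫ x, shiftedMin F h x ∂μ := by
  have hi := integrable_shiftedMin hF hFi (μ := μ)
  set k := Function.update h i t
  have hm := measurableSet_priceCell hF k i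
  have h1 : ∫ x, (priceCell F k i).indicator (fun _ => t - h i) x ∂μ =
      (t - h i) * μ.real (priceCell F k i) := by
    rw [integral_indicator_const _ hm, smul_eq_mul, mul_comm]
  rw [← h1, ← integral_sub (hi _) (hi _)]
  refine integral_mono ((integrable_const _).indicator hm) ((hi _).sub (hi _)) fun x => ?_
  -- On the new cell the minimum is F_i + t, while the old one was at most F_i + h_i. Off it the new
  -- minimum is attained at some j ≠ i, whose price has not changed.
  by_cases hx : x ∈ priceCell F k i
  · have h2 := mem_priceCell_iff.1 hx
    have h3 := shiftedMin_le F h x i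
    simp only [Set.indicator_of_mem hx]
    simp only [k, Function.update_self] at h2 ⊢
    linarith
  · obtain ⟨j, hj⟩ := exists_eq_shiftedMin F k x
    have hji : j ≠ i := by
      rintro rfl
      exact hx (mem_priceCell_iff.2 hj)
    simp only [Set.indicator_of_notMem hx]
    rw [← hj, sub_nonneg]
    simpa [k, hji] using shiftedMin_le F h x j

theorem TiesNull.ae_ne [Countable ι] (hties : TiesNull μ F) (h : ι → ℝ) :
    ∀ᵐ x ∂μ, ∀ i j, i ≠ j → F i x + h i ≠ F j x + h j := by
  rw [ae_all_iff]; intro i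
  rw [ae_all_iff]; intro j
  by_cases hij : i = j
  · simp [hij]
  · filter_upwards [measure_eq_zero_iff_ae_notMem.1 (hties i j hij (h j - h i))] with x hx _ he
    exact hx (show F i x - F j x = h j - h i by linarith)

/-- Without ties, the mass of a cell depends continuously on its price. -/
theorem tendsto_measure_priceCell_update [Fintype ι] [DecidableEq ι] [IsFiniteMeasure μ]
    (hF : ∀ i, Measurable (F i)) (hties : TiesNull μ F) (h : ι → ℝ) (i : ι) :
    Filter.Tendsto (fun t => μ.real (priceCell F (Function.update h i t) i)) (nhds (h i))
      (nhds (μ.real (priceCell F h i))) := by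
  refine (ENNReal.tendsto_toReal (measure_ne_top μ _)).comp ?_
  refine tendsto_measure_of_ae_tendsto_indicator (nhds (h i))
    (measurableSet_priceCell hF h i) (fun t => measurableSet_priceCell hF _ i)
    (B := Set.univ) MeasurableSet.univ (measure_ne_top μ _)
    (Filter.Eventually.of_forall fun _ => Set.subset_univ _) ?_
  filter_upwards [hties.ae_ne h] with x hx
  -- Off the ties each comparison at x is strict, so it survives a small change of price.
  have hj (j : ι) : ∀ᶠ t in nhds (h i),
      (F i x + Function.update h i t i ≤ F j x + Function.update h i t j ↔
        F i x + h i ≤ F j x + h j) := by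
    by_cases hji : j = i
    · subst hji; simp
    · simp only [Function.update_self, Function.update_of_ne hji]
      have hc : Filter.Tendsto (fun t => F i x + t) (nhds (h i)) (nhds (F i x + h i)) :=
        (continuous_const.add continuous_id).tendsto _
      rcases lt_or_gt_of_ne (hx i j (Ne.symm hji)) with hlt | hgt
      · filter_upwards [hc.eventually_lt_const hlt] with t ht
        exact iff_of_true ht.le hlt.le
      · filter_upwards [hc.eventually_const_lt hgt] with t ht
        exact iff_of_false ht.not_ge hgt.not_ge
  filter_upwards [Filter.eventually_all.2 hj] with t ht
  simp only [priceCell, Set.mem_ofPred_eq]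
  exact forall_congr' ht

end ShiftedMin

/-! ### Convex analysis of the load cost t s(t) on the half-line. -/

section LoadCost

variable {s : ℝ → ℝ}

theorem nonneg_of_monotoneOn (hs0 : s 0 = 0) (hmono : MonotoneOn s (Set.Ici 0)) {t : ℝ}
    (ht : 0 ≤ t) : 0 ≤ s t :=
  hs0 ▸ hmono Set.self_mem_Ici ht ht

theorem convexOn_mul_self (hs0 : s 0 = 0) (hmono : MonotoneOn s (Set.Ici 0))
    (hconv : ConvexOn ℝ (Set.Ici 0) s) : ConvexOn ℝ (Set.Ici 0) fun t => t * s t := by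
  refine (convexOn_id (convex_Ici 0)).mul hconv (fun _ hx => hx)
    (fun _ hx => nonneg_of_monotoneOn hs0 hmono hx) ?_
  intro _ ha _ hb hab
  by_contra hlt
  push Not at hlt
  exact absurd (hmono hb ha hlt.le) hab.not_ge

theorem monotoneOn_mul_self (hs0 : s 0 = 0) (hmono : MonotoneOn s (Set.Ici 0)) :
    MonotoneOn (fun t => t * s t) (Set.Ici 0) := fun _ ha _ hb hab =>
  mul_le_mul hab (hmono ha hb hab) (nonneg_of_monotoneOn hs0 hmono ha) hb

theorem continuousOn_mul_self (hs0 : s 0 = 0) (hmono : MonotoneOn s (Set.Ici 0))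
    (hconv : ConvexOn ℝ (Set.Ici 0) s) : ContinuousOn (fun t => t * s t) (Set.Ici 0) := by
  intro t ht
  rcases eq_or_lt_of_le (show (0 : ℝ) ≤ t from ht) with rfl | hpos
  · have hub : Filter.Tendsto (fun t : ℝ => t * s 1) (nhdsWithin 0 (Set.Ici 0)) (nhds 0) := by
      have : ContinuousWithinAt (fun t : ℝ => t * s 1) (Set.Ici 0) 0 := by fun_prop
      simpa [ContinuousWithinAt] using this
    show Filter.Tendsto _ _ (nhds (0 * s 0))
    rw [zero_mul]
    refine tendsto_of_tendsto_of_tendsto_of_le_of_le' tendsto_const_nhds hub ?_ ?_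
    · filter_upwards [self_mem_nhdsWithin] with u hu
      exact mul_nonneg hu (nonneg_of_monotoneOn hs0 hmono hu)
    · filter_upwards [self_mem_nhdsWithin,
        mem_nhdsWithin_of_mem_nhds (Iio_mem_nhds (zero_lt_one' ℝ))] with u hu hu1
      exact mul_le_mul_of_nonneg_left
        (hmono hu (Set.mem_Ici.2 zero_le_one) (le_of_lt hu1)) hu
  · have h1 : ContinuousOn s (Set.Ioi 0) := by
      simpa using hconv.continuousOn_interior
    exact (continuousAt_id.mul (h1.continuousAt (Ioi_mem_nhds hpos))).continuousWithinAt

/-- A subgradient of a load penalty `s` gives the subgradient `s n + n * g` of `t * s t`. -/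
theorem IsLoadSubgradient.mul_self {n g : ℝ} (hg : IsLoadSubgradient s n g) (hs0 : s 0 = 0)
    (hmono : MonotoneOn s (Set.Ici 0)) (hn : 0 ≤ n) {u : ℝ} (hu : 0 ≤ u) :
    n * s n + (s n + n * g) * (u - n) ≤ u * s u := by
  rcases eq_or_lt_of_le hn with rfl | hpos
  · rw [hs0]
    have := mul_nonneg hu (nonneg_of_monotoneOn hs0 hmono hu)
    linarith
  · have h0 := hg 0 le_rfl
    rw [hs0] at h0
    have hg0 : 0 ≤ g := by
      have := nonneg_of_monotoneOn hs0 hmono hn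
      by_contra hneg
      push Not at hneg
      nlinarith
    -- Inserting the subgradient bound for s(u) leaves a surplus of exactly g (u - n)².
    have h1 := mul_le_mul_of_nonneg_left (hg u hu) hu
    nlinarith [mul_nonneg hg0 (sq_nonneg (u - n))]

/-- Every subgradient `b ≥ 0` of `t * s t` has the form `s n + n * g` with a subgradient `g` of
`s`. -/
theorem exists_isLoadSubgradient (hs0 : s 0 = 0) (hmono : MonotoneOn s (Set.Ici 0))
    (hconv : ConvexOn ℝ (Set.Ici 0) s) {n b m : ℝ} (hn : 0 ≤ n) (hnm : n < m) (hb : 0 ≤ b)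
    (hmin : ∀ u, 0 ≤ u → u ≤ m → n * s n - b * n ≤ u * s u - b * u) :
    ∃ g, IsLoadSubgradient s n g ∧ b = s n + n * g := by
  rcases eq_or_lt_of_le hn with rfl | hpos
  · refine ⟨0, fun u hu => ?_, ?_⟩
    · simpa [hs0] using nonneg_of_monotoneOn hs0 hmono hu
    · rw [hs0]
      have hle (u : ℝ) (hu : 0 < u) (hum : u ≤ m) : b ≤ s u := by
        have := hmin u hu.le hum
        have h2 : u * b ≤ u * s u := by linarith
        exact le_of_mul_le_mul_left h2 hu
      -- Convexity and s(0) = 0 give s(r m) ≤ r s(m), which tends to 0 with r, so b cannot be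
      -- positive.
      have hlim (r : ℝ) (hr : 0 < r) (hr1 : r ≤ 1) : b ≤ r * s m := by
        have h1 := hle (r * m) (by positivity) (by nlinarith)
        have h2 := hconv.2 (Set.self_mem_Ici) (Set.mem_Ici.2 hnm.le) (sub_nonneg.2 hr1) hr.le
          (by ring)
        simp only [smul_eq_mul, mul_zero, zero_add, hs0] at h2
        exact h1.trans h2
      have hsm := hle m hnm le_rfl
      by_contra hb0
      have hbpos : 0 < b := lt_of_le_of_ne hb fun h => hb0 (by linarith)
      have hspos : 0 < s m := hbpos.trans_le hsm
      -- This choice of r yields b ≤ b / 2.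
      have := hlim (b / (2 * s m)) (by positivity) (by rw [div_le_one (by positivity)]; linarith)
      have h3 : b / (2 * s m) * s m = b / 2 := by field_simp
      linarith
  · obtain ⟨g, hbg⟩ : ∃ g, b = s n + n * g := ⟨(b - s n) / n, by field_simp; ring⟩
    refine ⟨g, fun u hu => ?_, hbg⟩
    have hslope {v : ℝ} (hv : 0 ≤ v) (hvm : v ≤ m) :
        0 ≤ v * (s v - s n) - n * g * (v - n) := by
      have := hmin v hv hvm
      rw [hbg] at this
      linarith
    rcases lt_trichotomy u n with hlt | rfl | hgt
    · have hq : ∀ v ∈ Set.Ioo u n, v * ((s n - s u) / (n - u)) ≤ n * g := by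
        intro v hv
        have h1 := hslope (hu.trans hv.1.le) (hv.2.le.trans hnm.le)
        have hvn : 0 < n - v := sub_pos.2 hv.2
        have h2 : (s n - s u) / (n - u) ≤ (s n - s v) / (n - v) := by
          have h := hconv.secant_mono (a := n) hn (x := u) (y := v) hu (hu.trans hv.1.le)
            hlt.ne hv.2.ne hv.1.le
          rw [← neg_sub (s n) (s u), ← neg_sub n u, neg_div_neg_eq, ← neg_sub (s n) (s v),
            ← neg_sub n v, neg_div_neg_eq] at h
          exact h
        have h3 : v * ((s n - s v) / (n - v)) ≤ n * g := by
          rw [← mul_div_assoc, div_le_iff₀ hvn]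
          linarith
        exact (mul_le_mul_of_nonneg_left h2 (hu.trans hv.1.le)).trans h3
      have hlim : n * ((s n - s u) / (n - u)) ≤ n * g := by
        have hc : Filter.Tendsto (fun v => v * ((s n - s u) / (n - u)))
            (nhdsWithin n (Set.Iio n)) (nhds (n * ((s n - s u) / (n - u)))) :=
          ((continuous_id.mul continuous_const).tendsto n).mono_left nhdsWithin_le_nhds
        refine le_of_tendsto hc ?_
        filter_upwards [Ioo_mem_nhdsLT hlt] with v hv using hq v hv
      have := le_of_mul_le_mul_left hlim hpos
      rw [div_le_iff₀ (sub_pos.2 hlt)] at this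
      linarith
    · simp
    -- Minimality is known only up to `m`; since n < m, points v near n suffice for every u.
    · have hq : ∀ v ∈ Set.Ioo n (min u m), n * g ≤ v * ((s u - s n) / (u - n)) := by
        intro v hv
        have hvu : v ≤ u := hv.2.le.trans (min_le_left _ _)
        have h1 := hslope (hn.trans hv.1.le) (hv.2.le.trans (min_le_right _ _))
        have hvn : 0 < v - n := sub_pos.2 hv.1
        have h2 := hconv.secant_mono (a := n) hn (x := v) (y := u) (hn.trans hv.1.le) hu
          hv.1.ne' hgt.ne' hvu
        have h3 : n * g ≤ v * ((s v - s n) / (v - n)) := by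
          rw [← mul_div_assoc, le_div_iff₀ hvn]
          linarith
        exact h3.trans (mul_le_mul_of_nonneg_left h2 (hn.trans hv.1.le))
      have hlim : n * g ≤ n * ((s u - s n) / (u - n)) := by
        have hc : Filter.Tendsto (fun v => v * ((s u - s n) / (u - n)))
            (nhdsWithin n (Set.Ioi n)) (nhds (n * ((s u - s n) / (u - n)))) :=
          ((continuous_id.mul continuous_const).tendsto n).mono_left nhdsWithin_le_nhds
        refine ge_of_tendsto hc ?_
        filter_upwards [Ioo_mem_nhdsGT (lt_min hgt hnm)] with v hv using hq v hv
      have := le_of_mul_le_mul_left hlim hpos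
      rw [le_div_iff₀ (sub_pos.2 hgt)] at this
      linarith

/-- A derivative inside the half-line is the only subgradient. -/
theorem IsLoadSubgradient.eq_deriv {n g : ℝ} (hg : IsLoadSubgradient s n g) (hn : 0 < n)
    (hd : DifferentiableAt ℝ s n) : g = deriv s n := by
  have hmin : IsLocalMin (fun u => s u - g * (u - n)) n := by
    filter_upwards [Ioi_mem_nhds hn] with u hu
    have := hg u (le_of_lt hu)
    simp only [sub_self, mul_zero, sub_zero]
    linarith
  have h1 : HasDerivAt (fun u => s u - g * (u - n)) (deriv s n - g * 1) n :=
    hd.hasDerivAt.sub (((hasDerivAt_id n).sub_const n).const_mul g)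
  have := hmin.hasDerivAt_eq_zero h1
  linarith

theorem isLoadSubgradient_deriv (hconv : ConvexOn ℝ (Set.Ici 0) s) {n : ℝ} (hn : 0 ≤ n)
    (hd : DifferentiableAt ℝ s n) : IsLoadSubgradient s n (deriv s n) := by
  intro u hu
  rcases lt_trichotomy u n with hlt | rfl | hgt
  · have := hconv.slope_le_deriv hu hn hlt hd
    rw [slope_def_field, div_le_iff₀ (sub_pos.2 hlt)] at this
    linarith
  · simp
  · have := hconv.deriv_le_slope hn hu hgt hd
    rw [slope_def_field, le_div_iff₀ (sub_pos.2 hgt)] at this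
    linarith

end LoadCost

/-! ### Existence of equilibrium prices. -/

/-- There are prices `h` for which every `h i` is the marginal cost of the load of the `i`-th
price cell: a saddle point of the Lagrangian provides them. -/
theorem exists_prices {α ι : Type*} {mα : MeasurableSpace α} {μ : Measure α} [IsFiniteMeasure μ]
    [Fintype ι] [Nonempty ι] {F : ι → α → ℝ} (hF : ∀ i, Measurable (F i))
    (hFi : ∀ i, Integrable (F i) μ) (hties : TiesNull μ F) {s : ι → ℝ → ℝ}
    (hs0 : ∀ i, s i 0 = 0) (hmono : ∀ i, MonotoneOn (s i) (Set.Ici 0))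
    (hconv : ∀ i, ConvexOn ℝ (Set.Ici 0) (s i)) :
    ∃ h g : ι → ℝ, ∀ i, IsLoadSubgradient (s i) (μ.real (priceCell F h i)) (g i) ∧
      h i = s i (μ.real (priceCell F h i)) + μ.real (priceCell F h i) * g i := by
  classical
  -- Every cell mass is at most `m - 1`. This unit of slack, together with `H > m * s i m`, keeps
  -- prices off their upper bound.
  set m : ℝ := μ.real Set.univ + 1 with hm
  have hm1 : 0 < m := by have := measureReal_nonneg (μ := μ) (s := Set.univ); linarith
  set H : ℝ := ∑ i, m * s i m + 1 with hH
  have hsm (i : ι) : 0 ≤ m * s i m :=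
    mul_nonneg hm1.le (nonneg_of_monotoneOn (hs0 i) (hmono i) hm1.le)
  have hHpos : 0 < H := by have := Finset.sum_nonneg fun i (_ : i ∈ Finset.univ) => hsm i; linarith
  have hHlt (i : ι) : m * s i m < H := by
    have := Finset.single_le_sum (fun i _ => hsm i) (Finset.mem_univ i)
    linarith
  set X : Set (ι → ℝ) := Set.univ.pi fun _ => Set.Icc 0 m
  set Y : Set (ι → ℝ) := Set.univ.pi fun _ => Set.Icc 0 H
  set Φ : (ι → ℝ) → ℝ := fun h => ∫ x, shiftedMin F h x ∂μ with hΦ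
  have hΦconc : ConcaveOn ℝ Set.univ Φ := concaveOn_integral_shiftedMin hF hFi
  have hΦcont : Continuous Φ := continuous_integral_shiftedMin hF hFi
  -- The loads t are free variables, and h is the multiplier for t_i = μ(C_i). Minimizing over the
  -- cells has already produced `Φ`.
  set L : (ι → ℝ) → (ι → ℝ) → ℝ := fun t h => Φ h + ∑ i, (t i * s i (t i) - h i * t i) with hL
  have cX : Convex ℝ X := convex_pi fun _ _ => convex_Icc 0 m
  have cY : Convex ℝ Y := convex_pi fun _ _ => convex_Icc 0 H
  obtain ⟨a, ha, b, hb, hab⟩ : ∃ a ∈ X, ∃ b ∈ Y, IsSaddlePointOn X Y L a b := by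
    refine Sion.exists_isSaddlePointOn ⟨fun _ => 0, fun _ _ => ⟨le_rfl, hm1.le⟩⟩ cX
      (isCompact_univ_pi fun _ => isCompact_Icc) ?_ ?_ cY
      ⟨fun _ => 0, fun _ _ => ⟨le_rfl, hHpos.le⟩⟩
      (isCompact_univ_pi fun _ => isCompact_Icc) ?_ ?_
    · intro h _
      refine ContinuousOn.lowerSemicontinuousOn ?_
      refine continuousOn_const.add (continuousOn_finsetSum _ fun i _ => ?_)
      refine ContinuousOn.sub ?_ (by fun_prop)
      exact (continuousOn_mul_self (hs0 i) (hmono i) (hconv i)).comp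
        (continuous_apply i).continuousOn fun t ht => (ht i trivial).1
    · intro h _
      refine ConvexOn.quasiconvexOn ⟨cX, fun t ht u hu p q hp hq hpq => ?_⟩
      have key (i : ι) := (convexOn_mul_self (hs0 i) (hmono i) (hconv i)).2
        (show t i ∈ Set.Ici (0 : ℝ) from (ht i trivial).1)
        (show u i ∈ Set.Ici (0 : ℝ) from (hu i trivial).1) hp hq hpq
      have hsum := Finset.sum_le_sum fun i (_ : i ∈ Finset.univ) => key i
      simp only [smul_eq_mul, hL, Pi.add_apply, Pi.smul_apply, Finset.sum_sub_distrib,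
        Finset.sum_add_distrib, ← Finset.mul_sum] at hsum ⊢
      have h1 : ∑ i, h i * (p * t i + q * u i) =
          p * ∑ i, h i * t i + q * ∑ i, h i * u i := by
        rw [Finset.mul_sum, Finset.mul_sum, ← Finset.sum_add_distrib]
        exact Finset.sum_congr rfl fun i _ => by ring
      have h2 : Φ h = p * Φ h + q * Φ h := by rw [← add_mul, hpq, one_mul]
      rw [h1]
      linarith
    · intro t _
      refine (Continuous.upperSemicontinuous ?_).upperSemicontinuousOn _
      simp only [hL]
      fun_prop
    · intro t _
      refine ConcaveOn.quasiconcaveOn ⟨cY, fun h hh k hk p q hp hq hpq => ?_⟩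
      have h0 := hΦconc.2 (Set.mem_univ h) (Set.mem_univ k) hp hq hpq
      simp only [smul_eq_mul, hL, Pi.add_apply, Pi.smul_apply, Finset.sum_sub_distrib] at h0 ⊢
      have h1 : ∑ i, (p * h i + q * k i) * t i =
          p * ∑ i, h i * t i + q * ∑ i, k i * t i := by
        rw [Finset.mul_sum, Finset.mul_sum, ← Finset.sum_add_distrib]
        exact Finset.sum_congr rfl fun i _ => by ring
      have h2 : ∑ i, t i * s i (t i) =
          p * ∑ i, t i * s i (t i) + q * ∑ i, t i * s i (t i) := by rw [← add_mul, hpq, one_mul]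
      rw [h1]
      linarith
  have hupd (c d : ι → ℝ) (i : ι) (v : ℝ) (G : ι → ℝ → ℝ → ℝ) :
      ∑ j, G j (Function.update c i v j) (d j) - ∑ j, G j (c j) (d j) =
        G i v (d i) - G i (c i) (d i) := by
    rw [← Finset.sum_sub_distrib, Finset.sum_eq_single i]
    · simp
    · intro j _ hj; simp [hj]
    · simp
  have hamin (i : ι) (u : ℝ) (hu : 0 ≤ u) (hum : u ≤ m) :
      a i * s i (a i) - b i * a i ≤ u * s i u - b i * u := by
    have hmem : Function.update a i u ∈ X := by
      intro j _
      by_cases hj : j = i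
      · subst hj; simpa using ⟨hu, hum⟩
      · simpa [hj] using ha j trivial
    have h1 := hab _ hmem b hb
    have h2 := hupd a b i u fun j x y => x * s j x - y * x
    simp only [hL] at h1
    linarith
  have hbmax (i : ι) (v : ℝ) (hv : 0 ≤ v) (hvH : v ≤ H) :
      Φ (Function.update b i v) - Φ b ≤ (v - b i) * a i := by
    have hmem : Function.update b i v ∈ Y := by
      intro j _
      by_cases hj : j = i
      · subst hj; simpa using ⟨hv, hvH⟩
      · simpa [hj] using hb j trivial
    have h1 := hab a ha _ hmem
    have h2 := hupd b a i v fun j x y => y * s j y - x * y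
    simp only [hL] at h1
    linarith
  have hcell (i : ι) (v : ℝ) (hv : 0 ≤ v) (hvH : v ≤ H) :
      (v - b i) * μ.real (priceCell F (Function.update b i v) i) ≤ (v - b i) * a i :=
    (mul_measure_priceCell_le hF hFi b i v).trans (hbmax i v hv hvH)
  -- Dividing `hcell` by v - b_i and letting v → b_i from the right or from the left gives the two
  -- bounds on the cell mass.
  have hupper (i : ι) (hi : b i < H) : μ.real (priceCell F b i) ≤ a i := by
    have ht := (tendsto_measure_priceCell_update hF hties b i).mono_left
      (nhdsWithin_le_nhds (s := Set.Ioi (b i)))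
    refine le_of_tendsto ht ?_
    filter_upwards [Ioo_mem_nhdsGT hi] with v hv
    exact le_of_mul_le_mul_left (hcell i v ((hb i trivial).1.trans hv.1.le) hv.2.le)
      (sub_pos.2 hv.1)
  have hlower (i : ι) (hi : 0 < b i) : a i ≤ μ.real (priceCell F b i) := by
    have ht := (tendsto_measure_priceCell_update hF hties b i).mono_left
      (nhdsWithin_le_nhds (s := Set.Iio (b i)))
    refine ge_of_tendsto ht ?_
    filter_upwards [Ioo_mem_nhdsLT hi] with v hv
    exact (mul_le_mul_left_of_neg (sub_neg.2 hv.2)).1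
      (hcell i v hv.1.le (hv.2.le.trans (hb i trivial).2))
  have hcellm (i : ι) : μ.real (priceCell F b i) ≤ m - 1 := by
    rw [hm, add_sub_cancel_right]
    exact measureReal_mono (Set.subset_univ _)
  -- At price H the load satisfies a_i ≤ m - 1, while comparison with the load m gives H (m - a_i) ≤
  -- m s_i(m) < H.
  have hbH (i : ι) : b i < H := by
    refine lt_of_le_of_ne (hb i trivial).2 fun he => ?_
    have h1 := (hlower i (he ▸ hHpos)).trans (hcellm i)
    have h2 := hamin i m hm1.le le_rfl
    have h3 : 0 ≤ a i * s i (a i) := mul_nonneg (ha i trivial).1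
      (nonneg_of_monotoneOn (hs0 i) (hmono i) (ha i trivial).1)
    have h4 := hHlt i
    rw [he] at h2
    nlinarith
  have hfin (i : ι) := by
    refine exists_isLoadSubgradient (hs0 i) (hmono i) (hconv i)
      (n := μ.real (priceCell F b i)) (b := b i) (m := m) measureReal_nonneg
      (by have := hcellm i; linarith) (hb i trivial).1 fun u hu hum => ?_
    have h1 := hamin i u hu hum
    -- At price 0 the cell mass may be below a_i, but t s_i(t) is non-decreasing, so the cell mass
    -- is a minimizer too.
    rcases eq_or_lt_of_le (hb i trivial).1 with h0 | h0
    · have h2 := monotoneOn_mul_self (hs0 i) (hmono i)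
        (Set.mem_Ici.2 measureReal_nonneg) (ha i trivial).1 (hupper i (hbH i))
      simp only [← h0, zero_mul, sub_zero] at h1 ⊢
      exact h2.trans h1
    · rwa [le_antisymm (hupper i (hbH i)) (hlower i h0)]
  choose g hg using hfin
  exact ⟨b, g, hg⟩

/-! ### Integration against the measure of mobiles. -/

section MobileMeasure

variable {Ω : Set Plane} {f : Plane → ℝ}

theorem isFiniteMeasure_mobileMeasure (hf_int : IntegrableOn f Ω) :
    IsFiniteMeasure (mobileMeasure Ω f) :=
  isFiniteMeasure_withDensity_ofReal hf_int.2

theorem mobileMeasure_absolutelyContinuous : mobileMeasure Ω f ≪ volume :=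
  (withDensity_absolutelyContinuous _ _).trans Measure.restrict_le_self.absolutelyContinuous

theorem ae_mem_mobileMeasure (hΩ : MeasurableSet Ω) : ∀ᵐ x ∂mobileMeasure Ω f, x ∈ Ω :=
  (withDensity_absolutelyContinuous _ _).ae_le (ae_restrict_mem hΩ)

theorem setIntegral_mobileMeasure (hf_nonneg : ∀ x ∈ Ω, 0 ≤ f x)
    (hf_int : IntegrableOn f Ω) {A : Set Plane} (hA : MeasurableSet A) (hAΩ : A ⊆ Ω)
    (G : Plane → ℝ) : ∫ x in A, G x ∂mobileMeasure Ω f = ∫ x in A, G x * f x := by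
  have hm : AEMeasurable (fun x => ENNReal.ofReal (f x)) (volume.restrict Ω) :=
    hf_int.aestronglyMeasurable.aemeasurable.ennreal_ofReal
  rw [mobileMeasure, setIntegral_withDensity_eq_setIntegral_toReal_smul₀ hm.restrict
    (Filter.Eventually.of_forall fun _ => ENNReal.ofReal_lt_top) _ hA,
    Measure.restrict_restrict hA, Set.inter_eq_left.2 hAΩ]
  refine setIntegral_congr_fun hA fun x hx => ?_
  simp only [ENNReal.toReal_ofReal (hf_nonneg x (hAΩ hx)), smul_eq_mul, mul_comm]

theorem mobilesIn_eq_measureReal (hf_nonneg : ∀ x ∈ Ω, 0 ≤ f x)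
    (hf_int : IntegrableOn f Ω) {A : Set Plane} (hA : MeasurableSet A) (hAΩ : A ⊆ Ω) :
    mobilesIn f A = (mobileMeasure Ω f).real A := by
  have := setIntegral_mobileMeasure hf_nonneg hf_int hA hAΩ 1
  simpa [mobilesIn] using this.symm

theorem integrable_mobileMeasure (hΩ : MeasurableSet Ω) (hf_nonneg : ∀ x ∈ Ω, 0 ≤ f x)
    (hf_int : IntegrableOn f Ω) {G : Plane → ℝ} (hG : IntegrableOn (fun x => G x * f x) Ω) :
    Integrable G (mobileMeasure Ω f) := by
  have hm : AEMeasurable (fun x => (f x).toNNReal) (volume.restrict Ω) :=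
    hf_int.aestronglyMeasurable.aemeasurable.real_toNNReal
  refine (integrable_withDensity_iff_integrable_smul₀ hm).2 ?_
  refine hG.congr ?_
  filter_upwards [ae_restrict_mem hΩ] with x hx
  rw [NNReal.smul_def, Real.coe_toNNReal _ (hf_nonneg x hx), smul_eq_mul, mul_comm]

end MobileMeasure

/-! ### Price cells are optimal, and uniquely so. -/

section Partition

variable {K : ℕ} {Ω : Set Plane} {μ : Measure Plane} {F : Fin K → Plane → ℝ}

theorem IsCellPartition.subset {C : Fin K → Set Plane} (hC : IsCellPartition Ω C) (i : Fin K) :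
    C i ⊆ Ω :=
  hC.iUnion_eq ▸ Set.subset_iUnion C i

/-- The price cells, with ties broken in favour of the smallest index, partition `Ω`. -/
theorem exists_isCellPartition_priceCell [Nonempty (Fin K)] (hΩ : MeasurableSet Ω)
    (hΩμ : ∀ᵐ x ∂μ, x ∈ Ω) (hF : ∀ i, Measurable (F i)) (hties : TiesNull μ F) (h : Fin K → ℝ) :
    ∃ C : Fin K → Set Plane, IsCellPartition Ω C ∧ ∀ i, C i =ᵐ[μ] priceCell F h i := by
  have hm := measurableSet_priceCell hF h
  refine ⟨fun i => (Ω ∩ priceCell F h i) \ ⋃ j, ⋃ _ : j < i, priceCell F h j, ⟨?_, ?_, ?_⟩, ?_⟩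
  · exact fun i => (hΩ.inter (hm i)).diff
      (MeasurableSet.iUnion fun j => MeasurableSet.iUnion fun _ => hm j)
  · intro i j hij
    rw [Set.disjoint_left]
    rintro x ⟨⟨_, hi⟩, hi'⟩ ⟨⟨_, hj⟩, hj'⟩
    simp only [Set.mem_iUnion, not_exists] at hi' hj'
    rcases lt_or_gt_of_ne hij with hlt | hgt
    · exact hj' i hlt hi
    · exact hi' j hgt hj
  · refine Set.Subset.antisymm (Set.iUnion_subset fun i x hx => hx.1.1) fun x hx => ?_
    classical
    have hne : (Finset.univ.filter fun i => x ∈ priceCell F h i).Nonempty := by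
      obtain ⟨j, hj⟩ := exists_eq_shiftedMin F h x
      exact ⟨j, by simpa using mem_priceCell_iff.2 hj⟩
    obtain ⟨i, hi, hmin⟩ := Finset.exists_min_image _ id hne
    simp only [Finset.mem_filter, Finset.mem_univ, true_and, id] at hi hmin
    refine Set.mem_iUnion.2 ⟨i, ⟨hx, hi⟩, ?_⟩
    simp only [Set.mem_iUnion, not_exists]
    exact fun j hj hjx => (hmin j hjx).not_gt hj
  · intro i
    filter_upwards [hΩμ, hties.ae_ne h] with x hx hne
    refine propext ⟨fun hi => hi.1.2, fun hi => ⟨⟨hx, hi⟩, ?_⟩⟩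
    simp only [Set.mem_iUnion, not_exists]
    intro j hj hjx
    exact hne i j hj.ne' (le_antisymm (hi j) (hjx i))

/-- The cost of serving the cells `C`, as a function of integrals with respect to the measure of
mobiles. -/
def loadCost (μ : Measure Plane) (F : Fin K → Plane → ℝ) (s : Fin K → ℝ → ℝ)
    (C : Fin K → Set Plane) : ℝ :=
  ∑ i, (∫ x in C i, F i x ∂μ + μ.real (C i) * s i (μ.real (C i)))

/-- Splitting of the linearized cost into the integral of the minimum and the excess over it. -/
theorem sum_setIntegral_eq_add_excess [Nonempty (Fin K)] [IsFiniteMeasure μ]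
    (hF : ∀ i, Measurable (F i)) (hFi : ∀ i, Integrable (F i) μ) (h : Fin K → ℝ)
    {D : Fin K → Set Plane} (hD : IsCellPartition Ω D) :
    ∑ i, (∫ x in D i, F i x ∂μ + h i * μ.real (D i)) =
      ∫ x in Ω, shiftedMin F h x ∂μ +
        ∑ i, ∫ x in D i, (F i x + h i - shiftedMin F h x) ∂μ := by
  have hi := integrable_shiftedMin hF hFi h
  rw [← hD.iUnion_eq, integral_iUnion_fintype hD.measurableSet hD.disjoint
    (fun i => hi.integrableOn), ← Finset.sum_add_distrib]
  refine Finset.sum_congr rfl fun i _ => ?_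
  have hsum : IntegrableOn (fun x => F i x + h i) (D i) μ :=
    ((hFi i).add (integrable_const (h i))).integrableOn
  rw [integral_sub hsum hi.integrableOn,
    integral_add (hFi i).integrableOn (integrable_const (h i)), setIntegral_const, smul_eq_mul]
  ring

/-- A partition into price cells, with marginal costs as prices, is optimal, and every optimal
partition agrees with it almost everywhere. -/
theorem loadCost_le_and_ae_eq [Nonempty (Fin K)] [IsFiniteMeasure μ]
    (hF : ∀ i, Measurable (F i)) (hFi : ∀ i, Integrable (F i) μ) (hΩμ : ∀ᵐ x ∂μ, x ∈ Ω)
    (hties : TiesNull μ F) {s : Fin K → ℝ → ℝ} {C : Fin K → Set Plane}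
    (hC : IsCellPartition Ω C) {h : Fin K → ℝ} (hCh : ∀ i, C i =ᵐ[μ] priceCell F h i)
    (hsub : ∀ i u, 0 ≤ u → μ.real (C i) * s i (μ.real (C i)) + h i * (u - μ.real (C i)) ≤ u * s i u)
    {D : Fin K → Set Plane} (hD : IsCellPartition Ω D) :
    loadCost μ F s C ≤ loadCost μ F s D ∧
      (loadCost μ F s D ≤ loadCost μ F s C → ∀ i, D i =ᵐ[μ] C i) := by
  have hi := integrable_shiftedMin hF hFi h
  set e : Fin K → Plane → ℝ := fun i x => F i x + h i - shiftedMin F h x with he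
  have he0 (i : Fin K) (x : Plane) : 0 ≤ e i x := sub_nonneg.2 (shiftedMin_le F h x i)
  have hei (i : Fin K) : Integrable (e i) μ := ((hFi i).add (integrable_const (h i))).sub hi
  have hDe (i : Fin K) : 0 ≤ ∫ x in D i, e i x ∂μ := integral_nonneg (he0 i)
  have hCe (i : Fin K) : ∫ x in C i, e i x ∂μ = 0 := by
    refine setIntegral_eq_zero_of_ae_eq_zero ?_
    filter_upwards [hCh i] with x hx hxC
    have : x ∈ priceCell F h i := (iff_of_eq hx).1 hxC
    exact sub_eq_zero.2 (mem_priceCell_iff.1 this)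
  have hsplitC := sum_setIntegral_eq_add_excess hF hFi h hC
  have hsplitD := sum_setIntegral_eq_add_excess hF hFi h hD
  have hsumsub := Finset.sum_le_sum fun i (_ : i ∈ Finset.univ) =>
    hsub i (μ.real (D i)) measureReal_nonneg
  have hC0 : ∑ i, ∫ x in C i, e i x ∂μ = 0 := Finset.sum_eq_zero fun i _ => hCe i
  -- The integral of the minimum over Ω is common to both partitions and cancels; the subgradient
  -- inequalities account for the load terms.
  have hmain : loadCost μ F s C + ∑ i, ∫ x in D i, e i x ∂μ ≤ loadCost μ F s D := by
    simp only [loadCost, mul_sub, Finset.sum_add_distrib, Finset.sum_sub_distrib]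
      at hsplitC hsplitD hsumsub ⊢
    simp only [he] at hC0 ⊢
    linarith
  have hDsum : 0 ≤ ∑ i, ∫ x in D i, e i x ∂μ := Finset.sum_nonneg fun i _ => hDe i
  refine ⟨by linarith, fun hle => ?_⟩
  have hzero : ∑ i, ∫ x in D i, e i x ∂μ = 0 := le_antisymm (by linarith) hDsum
  have hmem (i : Fin K) : ∀ᵐ x ∂μ, x ∈ D i → x ∈ priceCell F h i := by
    have h1 := (Finset.sum_eq_zero_iff_of_nonneg fun i _ => hDe i).1 hzero i (Finset.mem_univ i)
    have h2 := (setIntegral_eq_zero_iff_of_nonneg_ae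
      (Filter.Eventually.of_forall (he0 i)) (hei i).integrableOn).1 h1
    filter_upwards [(ae_restrict_iff' (hD.measurableSet i)).1 h2] with x hx hxD
    exact mem_priceCell_iff.2 (sub_eq_zero.1 (hx hxD))
  intro i
  refine Filter.EventuallyEq.trans ?_ (hCh i).symm
  filter_upwards [ae_all_iff.2 hmem, hΩμ, hties.ae_ne h] with x hx hxΩ hne
  refine propext ⟨hx i, fun hxi => ?_⟩
  -- A point of the i-th price cell lies in some D_j, hence in the j-th price cell; without ties j =
  -- i.
  rw [← hD.iUnion_eq] at hxΩ
  obtain ⟨j, hj⟩ := Set.mem_iUnion.1 hxΩ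
  have hji : j = i := by
    by_contra hne'
    exact hne j i hne' (le_antisymm (hx j hj i) (hxi j))
  exact hji ▸ hj

end Partition

/-! ### Translation to the original cost and cells. -/

section Cost

variable {K : ℕ} {Ω : Set Plane} {f : Plane → ℝ} {F : Fin K → Plane → ℝ}

theorem partitionCost_eq_loadCost (hf_nonneg : ∀ x ∈ Ω, 0 ≤ f x) (hf_int : IntegrableOn f Ω)
    (hFf : ∀ i, IntegrableOn (fun x => F i x * f x) Ω) (s : Fin K → ℝ → ℝ)
    {C : Fin K → Set Plane} (hC : IsCellPartition Ω C) :
    partitionCost F s f C = loadCost (mobileMeasure Ω f) F s C := by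
  refine Finset.sum_congr rfl fun i _ => ?_
  have hCi := hC.measurableSet i
  have hsub := hC.subset i
  rw [← mobilesIn_eq_measureReal hf_nonneg hf_int hCi hsub,
    setIntegral_mobileMeasure hf_nonneg hf_int hCi hsub]
  simp only [add_mul]
  rw [integral_add ((hFf i).mono_set hsub) ((hf_int.mono_set hsub).const_mul _),
    integral_const_mul, mul_comm (s i _)]
  rfl

theorem associationCell_ae_eq_priceCell {μ : Measure Plane} (hΩμ : ∀ᵐ x ∂μ, x ∈ Ω)
    (s : Fin K → ℝ → ℝ) (n g : Fin K → ℝ) (i : Fin K) :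
    associationCell Ω F s n g i =ᵐ[μ] priceCell F (fun k => s k (n k) + n k * g k) i := by
  filter_upwards [hΩμ] with x hx
  refine propext ?_
  show (x ∈ Ω ∧ ∀ j, F i x + s i (n i) + n i * g i ≤ F j x + s j (n j) + n j * g j) ↔
    ∀ j, F i x + (s i (n i) + n i * g i) ≤ F j x + (s j (n j) + n j * g j)
  simp only [hx, true_and, add_assoc]

end Cost

end

/-! ### Assembly of the three assertions. -/

theorem mainTheorem5 {K : ℕ} (hK : 0 < K)
    (Ω : Set Plane) (hΩ : MeasurableSet Ω)
    (f : Plane → ℝ) (hf_nonneg : ∀ x ∈ Ω, 0 ≤ f x) (hf_int : IntegrableOn f Ω)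
    (b : Fin K → Plane) (hb : Function.Injective b)
    (σ R ξ : ℝ) (hσ : 0 < σ) (hR : 0 ≤ R) (hξ : 0 < ξ)
    (hpow : ∀ i, IntegrableOn (fun x => linkPower σ R ξ (b i) x * f x) Ω)
    (MAX : Fin K → ℝ) (hMAX : ∀ i, 0 ≤ MAX i) (κbar : Fin K → ℝ → ℝ)
    (F : Fin K → Plane → ℝ) (hF : ∀ i, F i = linkPower σ R ξ (b i))
    (s : Fin K → ℝ → ℝ) (hs : ∀ i, s i = overflowPenalty (MAX i) (κbar i))
    (hs_mono : ∀ i, MonotoneOn (s i) (Set.Ici 0))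
    (hs_conv : ∀ i, ConvexOn ℝ (Set.Ici 0) (s i)) :
    (∃ C : Fin K → Set Plane, IsOptimalPartition Ω F s f C ∧
      ∀ D : Fin K → Set Plane, IsOptimalPartition Ω F s f D →
        ∀ i, D i =ᵐ[mobileMeasure Ω f] C i) ∧
    (∀ C : Fin K → Set Plane, IsCellPartition Ω C →
      (IsOptimalPartition Ω F s f C ↔
        ∃ g : Fin K → ℝ, (∀ i, IsLoadSubgradient (s i) (mobilesIn f (C i)) (g i)) ∧
          ∀ i, C i =ᵐ[mobileMeasure Ω f]
            associationCell Ω F s (fun k => mobilesIn f (C k)) g i)) ∧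
    (∀ C : Fin K → Set Plane, IsCellPartition Ω C →
      (∀ i, DifferentiableAt ℝ (s i) (mobilesIn f (C i))) →
      (IsOptimalPartition Ω F s f C ↔
        ∀ i, C i =ᵐ[mobileMeasure Ω f]
          associationCell Ω F s (fun k => mobilesIn f (C k))
            (fun k => deriv (s k) (mobilesIn f (C k))) i)) := by
  have : Nonempty (Fin K) := ⟨⟨0, hK⟩⟩
  have := isFiniteMeasure_mobileMeasure hf_int
  set μ := mobileMeasure Ω f
  have hs0 (i : Fin K) : s i 0 = 0 := by rw [hs, overflowPenalty, if_pos (hMAX i)]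
  have hFm (i : Fin K) : Measurable (F i) := hF i ▸ measurable_linkPower σ R ξ (b i)
  have hFf (i : Fin K) : IntegrableOn (fun x => F i x * f x) Ω := by rw [hF]; exact hpow i
  have hFi (i : Fin K) : Integrable (F i) μ :=
    integrable_mobileMeasure hΩ hf_nonneg hf_int (hFf i)
  have hΩμ : ∀ᵐ x ∂μ, x ∈ Ω := ae_mem_mobileMeasure hΩ
  have hties : TiesNull μ F := fun i j hij c => by
    rw [hF i, hF j]
    exact mobileMeasure_absolutelyContinuous
      (volume_setOf_linkPower_sub_eq hσ hξ (hb.ne hij) c)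
  have hN {C : Fin K → Set Plane} (hC : IsCellPartition Ω C) (i : Fin K) :
      mobilesIn f (C i) = μ.real (C i) :=
    mobilesIn_eq_measureReal hf_nonneg hf_int (hC.measurableSet i) (hC.subset i)
  have hcost {C : Fin K → Set Plane} (hC : IsCellPartition Ω C) :
      partitionCost F s f C = loadCost μ F s C :=
    partitionCost_eq_loadCost hf_nonneg hf_int hFf s hC
  have hsuff {C : Fin K → Set Plane} (hC : IsCellPartition Ω C) {g : Fin K → ℝ}
      (hg : ∀ i, IsLoadSubgradient (s i) (mobilesIn f (C i)) (g i))
      (hCg : ∀ i, C i =ᵐ[μ] associationCell Ω F s (fun k => mobilesIn f (C k)) g i) :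
      IsOptimalPartition Ω F s f C ∧
        ∀ D, IsOptimalPartition Ω F s f D → ∀ i, D i =ᵐ[μ] C i := by
    have key {D : Fin K → Set Plane} (hD : IsCellPartition Ω D) :=
      loadCost_le_and_ae_eq hFm hFi hΩμ hties (s := s) hC
        (fun i => (hCg i).trans (associationCell_ae_eq_priceCell hΩμ s _ g i))
        (fun i u hu => by
          rw [← hN hC i]
          exact (hg i).mul_self (hs0 i) (hs_mono i) (hN hC i ▸ measureReal_nonneg) hu) hD
    refine ⟨⟨hC, fun D hD => ?_⟩, fun D hD => (key hD.1).2 ?_⟩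
    · rw [hcost hC, hcost hD]
      exact (key hD).1
    · rw [← hcost hC, ← hcost hD.1]
      exact hD.2 C hC
  obtain ⟨h, g, hhg⟩ := exists_prices hFm hFi hties hs0 hs_mono hs_conv
  obtain ⟨C, hC, hCh⟩ := exists_isCellPartition_priceCell hΩ hΩμ hFm hties h
  -- Loads depend only on cells modulo null sets, so a single pair `h`, `g` serves every optimal
  -- partition.
  have hNh {D : Fin K → Set Plane} (hD : IsCellPartition Ω D) (hDC : ∀ i, D i =ᵐ[μ] C i)
      (i : Fin K) : mobilesIn f (D i) = μ.real (priceCell F h i) := by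
    rw [hN hD, measureReal_congr ((hDC i).trans (hCh i))]
  have hcells {D : Fin K → Set Plane} (hD : IsCellPartition Ω D) (hDC : ∀ i, D i =ᵐ[μ] C i) :
      (∀ i, IsLoadSubgradient (s i) (mobilesIn f (D i)) (g i)) ∧
        ∀ i, D i =ᵐ[μ] associationCell Ω F s (fun k => mobilesIn f (D k)) g i := by
    refine ⟨fun i => hNh hD hDC i ▸ (hhg i).1, fun i => ?_⟩
    refine ((hDC i).trans (hCh i)).trans ?_
    refine Filter.EventuallyEq.trans ?_ (associationCell_ae_eq_priceCell hΩμ s _ g i).symm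
    have : (fun k => s k (mobilesIn f (D k)) + mobilesIn f (D k) * g k) = h := by
      funext k
      rw [hNh hD hDC k, ← (hhg k).2]
    rw [this]
    exact Filter.EventuallyEq.rfl
  have hCcells := hcells hC fun i => Filter.EventuallyEq.rfl
  have hCopt := hsuff hC hCcells.1 hCcells.2
  have hiff (D : Fin K → Set Plane) (hD : IsCellPartition Ω D) :
      IsOptimalPartition Ω F s f D ↔
        ∃ g : Fin K → ℝ, (∀ i, IsLoadSubgradient (s i) (mobilesIn f (D i)) (g i)) ∧
          ∀ i, D i =ᵐ[μ] associationCell Ω F s (fun k => mobilesIn f (D k)) g i :=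
    ⟨fun hopt => ⟨g, hcells hD (hCopt.2 D hopt)⟩, fun ⟨_, hg, hDg⟩ => (hsuff hD hg hDg).1⟩
  refine ⟨⟨C, hCopt⟩, hiff, fun D hD hdiff => ?_⟩
  have hNnonneg (i : Fin K) : 0 ≤ mobilesIn f (D i) := hN hD i ▸ measureReal_nonneg
  rw [hiff D hD]
  constructor
  · rintro ⟨g', hg', hDg'⟩ i
    -- At zero load a subgradient need not be the derivative, but only its product with the load
    -- enters the cells.
    have hprod (k : Fin K) : mobilesIn f (D k) * g' k =
        mobilesIn f (D k) * deriv (s k) (mobilesIn f (D k)) := by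
      rcases eq_or_lt_of_le (hNnonneg k) with h0 | hpos
      · rw [← h0, zero_mul, zero_mul]
      · rw [(hg' k).eq_deriv hpos (hdiff k)]
    have := hDg' i
    simpa only [associationCell, hprod] using this
  · exact fun hDg => ⟨_, fun i => isLoadSubgradient_deriv (hs_conv i) (hNnonneg i) (hdiff i), hDg⟩
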